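/- A Delannoy path is a lattice path all of whose steps are north steps $N=(0,1)$, east steps $E=(1,0)$ or diagonal steps $D=(1,1)$. A peak (resp. valley) of a path is a pair of consecutive steps $NE$ (resp. $EN$). For $n\ge 0$ let $\mathcal{P}^{(2)}_{n,2n}(NE,EN)$ be the set of Delannoy paths from $(0,0)$ to $(n,2n)$ that stay on the half-plane $y\ge 2x$ and have no peaks and no valleys, and let $D\mathcal{P}^{(2)}_{n,2n}(NE,EN)$ be the set of those among them whose last step is the diagonal step $D$ (an empty set for $n=0$). Consider the generating functions $$F^{(2)}(x)=\sum_{n\ge 0}\#\mathcal{P}^{(2)}_{n,2n}(NE,EN)\,x^n,\qquad F_D^{(2)}(x)=\sum_{n\ge 1}\#D\mathcal{P}^{(2)}_{n,2n}(NE,EN)\,x^n .$$ **Theorem.** For every integer $n\ge 0$, $$[x^n]F^{(2)}(x)=\#\mathcal{P}^{(2)}_{n,2n}(NE,EN)=\sum_{m=0}^{n}\frac{(-1)^{n-m}}{m+1}\binom{3m+1}{m}\binom{m+1}{n-m},$$ $$[x^n]F_D^{(2)}(x)=\#D\mathcal{P}^{(2)}_{n,2n}(NE,EN)=\sum_{m=1}^{n}\frac{(-1)^{n-m}}{m}\binom{3m}{m-1}\binom{m}{n-m}.$$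 (The terms with $m>n$ are zero because $\binom{a}{b}=0$ for $b<0$; the second sum is empty for $n=0$.) -/

import Mathlib

namespace Delannoy

/-- The three steps allowed in a Delannoy path: north, east and diagonal. -/
inductive Step where
  | N : Step
  | E : Step
  | D : Step
  deriving DecidableEq

instance : Fintype Step where
  elems := {Step.N, Step.E, Step.D}
  complete := by intro s; cases s <;> simp

/-- The displacement of a step: `N = (0,1)`, `E = (1,0)`, `D = (1,1)`. -/
def Step.vec : Step → ℤ × ℤ
  | Step.N => (0, 1)
  | Step.E => (1, 0)
  | Step.D => (1, 1)

/-- The last point of the path that starts at the origin and takes the steps in the list,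
in order. -/
def endpoint (P : List Step) : ℤ × ℤ := (P.map Step.vec).sum

/-- The Delannoy paths from `(0,0)` to `(n,m)`, each given by its list of steps. -/
def paths (n m : ℕ) : Set (List Step) := {P | endpoint P = ((n : ℤ), (m : ℤ))}

/-- Every lattice point visited by the path lies on the half-plane `y ≥ k x`
(the half-plane being convex, so does the whole path). -/
def InHalfPlane (k : ℕ) (P : List Step) : Prop :=
  ∀ Q : List Step, Q <+: P → (k : ℤ) * (endpoint Q).1 ≤ (endpoint Q).2

/-- The pattern `w` does not occur as a block of consecutive steps of `P`. -/
def Avoids (w P : List Step) : Prop := ¬ w <:+: P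

/-- The Delannoy paths from `(0,0)` to `(n, k n)` on the half-plane `y ≥ k x` without
peaks `NE` and valleys `EN`. -/
def reducedPaths (k n : ℕ) : Set (List Step) :=
  {P | P ∈ paths n (k * n) ∧ InHalfPlane k P ∧
    Avoids [Step.N, Step.E] P ∧ Avoids [Step.E, Step.N] P}

/-- The members of `reducedPaths k n` whose last step is diagonal. -/
def reducedPathsD (k n : ℕ) : Set (List Step) :=
  {P | P ∈ reducedPaths k n ∧ P.getLast? = some Step.D}

/-- There are finitely many Delannoy paths to a given point, so that the cardinalities
`Set.ncard` below are the true ones. -/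
theorem paths_finite (n m : ℕ) : (paths n m).Finite := by
  have key : ∀ P : List Step, (P.length : ℤ) ≤ (endpoint P).1 + (endpoint P).2 := by
    intro P
    induction P with
    | nil => simp [endpoint]
    | cons s P ih =>
      simp only [endpoint, List.map_cons, List.sum_cons, Prod.fst_add, Prod.snd_add,
        List.length_cons] at ih ⊢
      push_cast
      cases s <;> simp only [Step.vec] <;> linarith
  refine (List.finite_length_le Step (n + m)).subset ?_
  intro P hP
  have h := key P
  have hP' : endpoint P = ((n : ℤ), (m : ℤ)) := hP
  rw [hP'] at h
  have h' : (P.length : ℤ) ≤ (n : ℤ) + (m : ℤ) := h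
  show P.length ≤ n + m
  exact_mod_cast h'

/-- The generating function `F = ∑_{n ≥ 0} #(reducedPaths k n) xⁿ`. -/
noncomputable def F (k : ℕ) : PowerSeries ℚ :=
  PowerSeries.mk fun n => ((reducedPaths k n).ncard : ℚ)

/-- The generating function `F_D = ∑_{n ≥ 1} #(reducedPathsD k n) xⁿ`
(the set for `n = 0` is empty, the only path there having no last step). -/
noncomputable def FD (k : ℕ) : PowerSeries ℚ :=
  PowerSeries.mk fun n => if n = 0 then 0 else ((reducedPathsD k n).ncard : ℚ)

end Delannoy

namespace Delannoy

open PowerSeries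

/-! Measure a path by its height `y - 2x`: `N` raises it by 1, `D` lowers it by 1, `E` lowers it by
2. Deleting the last step of a peak- and valley-free path gives linear recurrences for the series
`N_h`, `D_h`, `E_h` of paths ending at height `h` with a given step. With `B = 1 + x(1-x)B^3` they
are solved by `N_h = B^h`, `D_h = B^(h+1) - B^h`, `E_h = (1-x)B^(h+2) - B^(h+1)`. At height 0 the
sum of the three is `(1-x)B^2` and the diagonal part is `B - 1`. Expanding powers of `B` in
Fuss–Catalan numbers at `z = x(1-x)` yields the two formulas. Only `B^0 = 1` and the linear relation
`B^(r+1) = B^r + x(1-x)B^(r+3)` are needed, never multiplicativity in `r`. -/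

/-! ### Fuss–Catalan numbers -/

/-- The Fuss–Catalan number `r / (3 m + r) * (3 m + r).choose m`, the coefficient of `z ^ m` in the
`r`-th power of the series `B` with `B = 1 + z * B ^ 3`. -/
def fussCatalan (r : ℕ) : ℕ → ℚ
  | 0 => 1
  -- One factor of the binomial is cancelled against `3 m + r`, so the case `r = 0` needs no special
  -- treatment.
  | m + 1 => r / (m + 1) * (3 * m + 2 + r).choose m

/-- Coefficient form of `B^(r+1) = B^r + z B^(r+3)`. Pascal's rule leaves two adjacent binomials,
tied together by the absorption identity. -/
theorem fussCatalan_succ (r m : ℕ) :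
    fussCatalan (r + 1) (m + 1) = fussCatalan r (m + 1) + fussCatalan (r + 3) m := by
  cases m with
  | zero => simp [fussCatalan]
  | succ k =>
    have h1 : (3 * (k + 1) + 2 + (r + 1)).choose (k + 1) =
        (3 * k + 2 + (r + 3)).choose k + (3 * (k + 1) + 2 + r).choose (k + 1) := by
      rw [show 3 * (k + 1) + 2 + (r + 1) = (3 * k + 2 + (r + 3)) + 1 by ring, Nat.choose_succ_succ,
        show 3 * (k + 1) + 2 + r = 3 * k + 2 + (r + 3) by ring]
    have h2 := Nat.choose_succ_right_eq (3 * k + 2 + (r + 3)) k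
    rw [show 3 * k + 2 + (r + 3) - k = 2 * k + 5 + r by omega] at h2
    have h3 : 3 * (k + 1) + 2 + r = 3 * k + 2 + (r + 3) := by ring
    simp only [fussCatalan, h1]
    rw [h3]
    have h4 : (((3 * k + 2 + (r + 3)).choose (k + 1) : ℕ) : ℚ) * (k + 1) =
        ((3 * k + 2 + (r + 3)).choose k : ℕ) * (2 * k + 5 + r) := by exact_mod_cast h2
    push_cast
    have : (k : ℚ) + 1 ≠ 0 := by positivity
    have : (k : ℚ) + 1 + 1 ≠ 0 := by positivity
    field_simp
    linear_combination h4

theorem fussCatalan_zero_left (m : ℕ) : fussCatalan 0 m = if m = 0 then 1 else 0 := by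
  cases m <;> simp [fussCatalan]

theorem fussCatalan_one {m : ℕ} (hm : 1 ≤ m) :
    fussCatalan 1 m = ((3 * m).choose (m - 1) : ℚ) / m := by
  obtain ⟨k, rfl⟩ := Nat.exists_eq_add_of_le' hm
  simp only [fussCatalan, Nat.add_sub_cancel]
  rw [show 3 * (k + 1) = 3 * k + 2 + 1 by ring]
  push_cast
  ring

theorem fussCatalan_two (m : ℕ) :
    fussCatalan 2 m = ((3 * m + 1).choose m : ℚ) / (m + 1) := by
  cases m with
  | zero => simp [fussCatalan]
  | succ k =>
    have h2 := Nat.choose_succ_right_eq (3 * k + 2 + 2) k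
    rw [show 3 * k + 2 + 2 - k = 2 * (k + 2) by omega] at h2
    simp only [fussCatalan]
    rw [show 3 * (k + 1) + 1 = 3 * k + 2 + 2 by ring]
    have h4 : (((3 * k + 2 + 2).choose (k + 1) : ℕ) : ℚ) * (k + 1) =
        ((3 * k + 2 + 2).choose k : ℕ) * (2 * (k + 2)) := by exact_mod_cast h2
    push_cast
    have : (k : ℚ) + 1 ≠ 0 := by positivity
    have : (k : ℚ) + 1 + 1 ≠ 0 := by positivity
    field_simp
    linear_combination -h4

/-! ### Powers of `B` and their coefficients -/

/-- The series `B ^ r`, where `B = 1 + x * (1 - x) * B ^ 3`. -/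
noncomputable def ternaryPow (r : ℕ) : ℚ⟦X⟧ :=
  (PowerSeries.mk (fussCatalan r)).subst (X * (1 - X) : ℚ⟦X⟧)

theorem hasSubst_X_mul_one_sub_X : HasSubst (X * (1 - X) : ℚ⟦X⟧) :=
  HasSubst.of_constantCoeff_zero' (by simp)

theorem ternaryPow_zero : ternaryPow 0 = 1 := by
  have : PowerSeries.mk (fussCatalan 0) = (1 : ℚ⟦X⟧) := by
    ext m
    simp [fussCatalan_zero_left, coeff_one]
  rw [ternaryPow, this, ← coe_substAlgHom hasSubst_X_mul_one_sub_X, map_one]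

theorem ternaryPow_succ (r : ℕ) :
    ternaryPow (r + 1) = ternaryPow r + X * (1 - X) * ternaryPow (r + 3) := by
  have : PowerSeries.mk (fussCatalan (r + 1)) =
      (PowerSeries.mk (fussCatalan r) + X * PowerSeries.mk (fussCatalan (r + 3)) : ℚ⟦X⟧) := by
    ext m
    cases m with
    | zero => simp [fussCatalan]
    | succ m => simp [coeff_succ_X_mul, fussCatalan_succ]
  have hs := hasSubst_X_mul_one_sub_X
  rw [ternaryPow, this, subst_add hs, subst_mul hs, subst_X hs]
  rfl

theorem coeff_one_sub_X_pow (m k : ℕ) :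
    coeff k ((1 - X : ℚ⟦X⟧) ^ m) = (-1) ^ k * (m.choose k : ℚ) := by
  induction m generalizing k with
  | zero => cases k <;> simp [coeff_one]
  | succ m ih =>
    rw [pow_succ', sub_mul, one_mul, map_sub, ih]
    cases k with
    | zero => simp
    | succ k =>
      rw [coeff_succ_X_mul, ih, Nat.choose_succ_succ]
      push_cast
      ring

theorem coeff_X_pow_mul_one_sub_X_pow {m n : ℕ} (h : m ≤ n) (j : ℕ) :
    coeff n ((X : ℚ⟦X⟧) ^ m * (1 - X) ^ j) = (-1) ^ (n - m) * (j.choose (n - m) : ℚ) := by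
  rw [coeff_X_pow_mul', if_pos h, coeff_one_sub_X_pow]

/-- Terms with `m > n` vanish because `X ^ m` divides them. The cutoff `M` is free so that two
consecutive coefficients can be summed over one range. -/
theorem coeff_ternaryPow (r : ℕ) {n M : ℕ} (h : n < M) :
    coeff n (ternaryPow r) =
      ∑ m ∈ Finset.range M, fussCatalan r m * coeff n ((X * (1 - X) : ℚ⟦X⟧) ^ m) := by
  rw [ternaryPow, coeff_subst' hasSubst_X_mul_one_sub_X]
  simp only [coeff_mk, smul_eq_mul]
  apply finsum_eq_sum_of_support_subset
  intro m hm
  simp only [Function.mem_support] at hm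
  simp only [Finset.coe_range, Set.mem_Iio]
  by_contra hM
  apply hm
  rw [mul_pow, coeff_X_pow_mul', if_neg (by omega), mul_zero]

theorem coeff_one_sub_X_mul_ternaryPow (r n : ℕ) :
    coeff n ((1 - X) * ternaryPow r) = ∑ m ∈ Finset.range (n + 1),
      fussCatalan r m * ((-1) ^ (n - m) * ((m + 1).choose (n - m) : ℚ)) := by
  have key : coeff n ((1 - X) * ternaryPow r) = ∑ m ∈ Finset.range (n + 1),
      fussCatalan r m * coeff n ((1 - X) * (X * (1 - X) : ℚ⟦X⟧) ^ m) := by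
    simp only [sub_mul (1 : ℚ⟦X⟧), one_mul, map_sub, mul_sub (fussCatalan _ _), Finset.sum_sub_distrib]
    rw [coeff_ternaryPow r n.lt_succ_self]
    congr 1
    cases n with
    | zero => simp
    | succ n => 
      simp only [coeff_succ_X_mul]
      exact coeff_ternaryPow r (n.lt_succ_self.trans (Nat.lt_succ_self _))
  rw [key]
  refine Finset.sum_congr rfl fun m hm => ?_
  rw [← coeff_X_pow_mul_one_sub_X_pow (by simpa [Nat.lt_succ_iff] using hm)]
  -- The extra `1 - X` joins the `m`-th power, hence `m + 1` in the binomial.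
  rw [mul_pow, pow_succ', mul_left_comm]

theorem coeff_ternaryPow_one_sub_one (n : ℕ) :
    coeff n (ternaryPow 1 - ternaryPow 0) = ∑ m ∈ Finset.Icc 1 n,
      fussCatalan 1 m * ((-1) ^ (n - m) * (m.choose (n - m) : ℚ)) := by
  -- The summand `m = 0` is the constant series 1, which cancels `ternaryPow 0`.
  rw [map_sub, coeff_ternaryPow 1 n.lt_succ_self, ternaryPow_zero, Finset.range_eq_Ico,
    Finset.sum_eq_sum_Ico_succ_bot (Nat.succ_pos n)]
  simp only [fussCatalan, pow_zero, one_mul, add_sub_cancel_left]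
  rw [show Finset.Ico (0 + 1) n.succ = Finset.Icc 1 n from rfl]
  refine Finset.sum_congr rfl fun m hm => ?_
  rw [← coeff_X_pow_mul_one_sub_X_pow (Finset.mem_Icc.1 hm).2, mul_pow]

/-! ### Closed forms solving the last-step recurrences -/

/-- The generating function, by final abscissa, of the paths that end at height `h` above the line
`y = 2 x` with the given last step, the empty path counting as one that ends with `N`. -/
noncomputable def lastStepSeries : Step → ℕ → ℚ⟦X⟧
  | Step.N, h => ternaryPow h
  | Step.D, h => ternaryPow (h + 1) - ternaryPow h
  | Step.E, h => (1 - X) * ternaryPow (h + 2) - ternaryPow (h + 1)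

theorem lastStepSeries_N_succ (h : ℕ) : lastStepSeries Step.N (h + 1) =
    lastStepSeries Step.N h + lastStepSeries Step.D h := by
  simp only [lastStepSeries]
  ring

theorem lastStepSeries_D (h : ℕ) : lastStepSeries Step.D h =
    X * (lastStepSeries Step.N (h + 1) + lastStepSeries Step.D (h + 1) +
      lastStepSeries Step.E (h + 1)) := by
  simp only [lastStepSeries]
  rw [ternaryPow_succ h]
  ring

theorem lastStepSeries_E (h : ℕ) : lastStepSeries Step.E h =
    X * (lastStepSeries Step.D (h + 2) + lastStepSeries Step.E (h + 2)) := by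
  simp only [lastStepSeries]
  linear_combination ternaryPow_succ (h + 1)

/-! ### Paths sorted by last step -/

theorem endpoint_concat (P : List Step) (s : Step) :
    endpoint (P ++ [s]) = endpoint P + s.vec := by
  simp [endpoint]

theorem endpoint_fst_nonneg (P : List Step) : 0 ≤ (endpoint P).1 := by
  induction P using List.reverseRecOn with
  | nil => simp [endpoint]
  | append_singleton P s ih =>
    rw [endpoint_concat]
    cases s <;> simp [Step.vec] <;> omega

theorem inHalfPlane_concat (k : ℕ) (P : List Step) (s : Step) :
    InHalfPlane k (P ++ [s]) ↔
      InHalfPlane k P ∧ (k : ℤ) * (endpoint (P ++ [s])).1 ≤ (endpoint (P ++ [s])).2 := by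
  simp only [InHalfPlane, List.prefix_concat_iff]
  exact ⟨fun h => ⟨fun Q hQ => h Q (Or.inr hQ), h _ (Or.inl rfl)⟩,
    fun h Q hQ => hQ.elim (fun e => e ▸ h.2) (h.1 Q)⟩

theorem avoids_pair_concat (a b s : Step) (P : List Step) :
    Avoids [a, b] (P ++ [s]) ↔ Avoids [a, b] P ∧ ¬ (P.getLast? = some a ∧ s = b) := by
  have hs : [a, b] <:+ P ++ [s] ↔ P.getLast? = some a ∧ s = b := by
    rw [show [a, b] = [a] ++ [b] from rfl, List.suffix_concat_iff]
    simp only [List.append_eq_nil_iff, List.cons_ne_self, and_false, false_or]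
    constructor
    · rintro ⟨t, h, ⟨u, rfl⟩⟩
      obtain ⟨rfl, h⟩ := List.append_inj' h rfl
      simp at h
      simp [h]
    · rintro ⟨h, rfl⟩
      obtain ⟨u, rfl⟩ := List.getLast?_eq_some_iff.1 h
      exact ⟨[a], rfl, ⟨u, rfl⟩⟩
  rw [Avoids, List.infix_concat_iff, hs, Avoids]
  tauto

/-- The paths above the line `y = 2 x` without peaks and valleys that end at abscissa `n` and
height `h` above that line with the last step `s`, the empty path counting as one that ends
with `N`. -/
def pathsWithLast (s : Step) (h n : ℕ) : Set (List Step) :=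
  {P | endpoint P = ((n : ℤ), ((2 * n + h : ℕ) : ℤ)) ∧ InHalfPlane 2 P ∧
    Avoids [Step.N, Step.E] P ∧ Avoids [Step.E, Step.N] P ∧ P.getLast?.getD Step.N = s}

theorem pathsWithLast_finite (s : Step) (h n : ℕ) : (pathsWithLast s h n).Finite :=
  (paths_finite n (2 * n + h)).subset fun _ hP => hP.1

theorem disjoint_pathsWithLast {s t : Step} (hst : s ≠ t) (h n : ℕ) :
    Disjoint (pathsWithLast s h n) (pathsWithLast t h n) :=
  Set.disjoint_left.2 fun _ hs ht => hst (hs.2.2.2.2.symm.trans ht.2.2.2.2)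

theorem ncard_pathsWithLast_union {s t : Step} (hst : s ≠ t) (h n : ℕ) :
    (pathsWithLast s h n ∪ pathsWithLast t h n).ncard =
      (pathsWithLast s h n).ncard + (pathsWithLast t h n).ncard :=
  Set.ncard_union_eq (disjoint_pathsWithLast hst h n) (pathsWithLast_finite s h n)
    (pathsWithLast_finite t h n)

theorem ncard_pathsWithLast_union_three (h n : ℕ) :
    (pathsWithLast Step.N h n ∪ pathsWithLast Step.D h n ∪ pathsWithLast Step.E h n).ncard =
      (pathsWithLast Step.N h n).ncard + (pathsWithLast Step.D h n).ncard +
        (pathsWithLast Step.E h n).ncard := by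
  rw [Set.ncard_union_eq (Set.disjoint_union_left.2
      ⟨disjoint_pathsWithLast (by decide) h n, disjoint_pathsWithLast (by decide) h n⟩)
    ((pathsWithLast_finite _ h n).union (pathsWithLast_finite _ h n)) (pathsWithLast_finite _ h n),
    ncard_pathsWithLast_union (by decide)]

theorem concat_injective (s : Step) : Function.Injective fun P : List Step => P ++ [s] :=
  fun _ _ h => List.append_cancel_right h

theorem eq_concat_of_getLast?_getD {P : List Step} {s : Step} (hP : P ≠ [])
    (h : P.getLast?.getD Step.N = s) : ∃ Q, P = Q ++ [s] := by
  refine ⟨P.dropLast, ?_⟩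
  rw [List.getLast?_eq_some_getLast hP, Option.getD_some] at h
  rw [← h, List.dropLast_append_getLast]

theorem inHalfPlane_nil (k : ℕ) : InHalfPlane k [] := by
  intro Q hQ
  simp [List.prefix_nil.1 hQ, endpoint]

theorem concat_mem_pathsWithLast (P : List Step) (s : Step) (h n : ℕ) :
    P ++ [s] ∈ pathsWithLast s h n ↔
      endpoint P + s.vec = ((n : ℤ), ((2 * n + h : ℕ) : ℤ)) ∧ InHalfPlane 2 P ∧
      Avoids [Step.N, Step.E] P ∧ Avoids [Step.E, Step.N] P ∧
      ¬ (P.getLast? = some Step.N ∧ s = Step.E) ∧ ¬ (P.getLast? = some Step.E ∧ s = Step.N) := by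
  simp only [pathsWithLast, Set.mem_ofPred_eq, endpoint_concat, inHalfPlane_concat,
    avoids_pair_concat, List.getLast?_concat, Option.getD_some, and_true]
  constructor
  · tauto
  · rintro ⟨h1, h2, h3, h4, h5, h6⟩
    refine ⟨h1, ⟨h2, ?_⟩, ⟨h3, h5⟩, h4, h6⟩
    -- The new endpoint is in the half-plane because its height `h` is a natural number.
    rw [h1]
    push_cast
    omega

theorem pathsWithLast_N_zero_zero : pathsWithLast Step.N 0 0 = {[]} := by
  ext P
  rw [Set.mem_singleton_iff]
  constructor
  · intro hP
    by_contra hne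
    obtain ⟨Q, rfl⟩ := eq_concat_of_getLast?_getD hne hP.2.2.2.2
    rw [concat_mem_pathsWithLast] at hP
    -- A final `N` at height 0 would come from height -1.
    have h1 := hP.2.1 Q List.prefix_rfl
    have h2 := hP.1
    simp only [Step.vec, Prod.ext_iff, Prod.fst_add, Prod.snd_add] at h2
    push_cast at h1 h2
    omega
  · rintro rfl
    exact ⟨rfl, inHalfPlane_nil 2, by simp [Avoids], by simp [Avoids], rfl⟩

theorem pathsWithLast_N_zero_succ (n : ℕ) : pathsWithLast Step.N 0 (n + 1) = ∅ := by
  rw [Set.eq_empty_iff_forall_notMem]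
  intro P hP
  have hne : P ≠ [] := by
    rintro rfl
    have h2 := hP.1
    simp only [endpoint, List.map_nil, List.sum_nil, Prod.ext_iff, Prod.fst_zero] at h2
    push_cast at h2
    omega
  obtain ⟨Q, rfl⟩ := eq_concat_of_getLast?_getD hne hP.2.2.2.2
  rw [concat_mem_pathsWithLast] at hP
  have h1 := hP.2.1 Q List.prefix_rfl
  have h2 := hP.1
  simp only [Step.vec, Prod.ext_iff, Prod.fst_add, Prod.snd_add] at h2
  push_cast at h1 h2
  omega

theorem pathsWithLast_D_zero (h : ℕ) : pathsWithLast Step.D h 0 = ∅ := by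
  rw [Set.eq_empty_iff_forall_notMem]
  intro P hP
  have hne : P ≠ [] := by rintro rfl; exact absurd hP.2.2.2.2 (by decide)
  obtain ⟨Q, rfl⟩ := eq_concat_of_getLast?_getD hne hP.2.2.2.2
  rw [concat_mem_pathsWithLast] at hP
  have h1 := endpoint_fst_nonneg Q
  have h2 := hP.1
  simp only [Step.vec, Prod.ext_iff, Prod.fst_add, Prod.snd_add] at h2
  push_cast at h2
  omega

theorem pathsWithLast_E_zero (h : ℕ) : pathsWithLast Step.E h 0 = ∅ := by
  rw [Set.eq_empty_iff_forall_notMem]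
  intro P hP
  have hne : P ≠ [] := by rintro rfl; exact absurd hP.2.2.2.2 (by decide)
  obtain ⟨Q, rfl⟩ := eq_concat_of_getLast?_getD hne hP.2.2.2.2
  rw [concat_mem_pathsWithLast] at hP
  have h1 := endpoint_fst_nonneg Q
  have h2 := hP.1
  simp only [Step.vec, Prod.ext_iff, Prod.fst_add, Prod.snd_add] at h2
  push_cast at h2
  omega

theorem pathsWithLast_N_succ (h n : ℕ) : pathsWithLast Step.N (h + 1) n =
    (fun P => P ++ [Step.N]) '' (pathsWithLast Step.N h n ∪ pathsWithLast Step.D h n) := by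
  ext P
  constructor
  · intro hP
    have hne : P ≠ [] := by
      rintro rfl
      have h2 := hP.1
      simp only [endpoint, List.map_nil, List.sum_nil, Prod.ext_iff, Prod.fst_zero,
        Prod.snd_zero] at h2
      push_cast at h2
      omega
    obtain ⟨Q, rfl⟩ := eq_concat_of_getLast?_getD hne hP.2.2.2.2
    refine ⟨Q, ?_, rfl⟩
    rw [concat_mem_pathsWithLast] at hP
    obtain ⟨h1, h2, h3, h4, -, h6⟩ := hP
    have he : endpoint Q = ((n : ℤ), ((2 * n + h : ℕ) : ℤ)) := by
      simp only [Step.vec, Prod.ext_iff, Prod.fst_add, Prod.snd_add] at h1 ⊢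
      push_cast at h1 ⊢
      omega
    cases hs : Q.getLast?.getD Step.N with
    | N => exact Or.inl ⟨he, h2, h3, h4, hs⟩
    | D => exact Or.inr ⟨he, h2, h3, h4, hs⟩
    | E =>
      cases hl : Q.getLast? with
      | none => simp [hl] at hs
      | some t => simp [hl] at hs; exact absurd ⟨hs ▸ hl, rfl⟩ h6
  · rintro ⟨Q, hQ, rfl⟩
    have hs : ∃ s, s ≠ Step.E ∧ Q ∈ pathsWithLast s h n :=
      hQ.elim (fun hQ => ⟨_, by decide, hQ⟩) (fun hQ => ⟨_, by decide, hQ⟩)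
    obtain ⟨s, hs, h1, h2, h3, h4, h5⟩ := hs
    refine (concat_mem_pathsWithLast _ _ _ _).2 ⟨?_, h2, h3, h4, by simp, ?_⟩
    · rw [h1]
      simp only [Step.vec, Prod.ext_iff, Prod.fst_add, Prod.snd_add]
      push_cast
      omega
    · rintro ⟨h6, -⟩
      rw [h6] at h5
      exact hs h5.symm

theorem pathsWithLast_D_succ (h n : ℕ) : pathsWithLast Step.D h (n + 1) =
    (fun P => P ++ [Step.D]) '' (pathsWithLast Step.N (h + 1) n ∪ pathsWithLast Step.D (h + 1) n ∪
      pathsWithLast Step.E (h + 1) n) := by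
  ext P
  constructor
  · intro hP
    have hne : P ≠ [] := by rintro rfl; exact absurd hP.2.2.2.2 (by decide)
    obtain ⟨Q, rfl⟩ := eq_concat_of_getLast?_getD hne hP.2.2.2.2
    refine ⟨Q, ?_, rfl⟩
    rw [concat_mem_pathsWithLast] at hP
    obtain ⟨h1, h2, h3, h4, -, -⟩ := hP
    have he : endpoint Q = ((n : ℤ), ((2 * n + (h + 1) : ℕ) : ℤ)) := by
      simp only [Step.vec, Prod.ext_iff, Prod.fst_add, Prod.snd_add] at h1 ⊢
      push_cast at h1 ⊢
      omega
    cases hs : Q.getLast?.getD Step.N with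
    | N => exact Or.inl (Or.inl ⟨he, h2, h3, h4, hs⟩)
    | D => exact Or.inl (Or.inr ⟨he, h2, h3, h4, hs⟩)
    | E => exact Or.inr ⟨he, h2, h3, h4, hs⟩
  · rintro ⟨Q, hQ, rfl⟩
    have hs : ∃ s, Q ∈ pathsWithLast s (h + 1) n :=
      hQ.elim (fun hQ => hQ.elim (fun hQ => ⟨_, hQ⟩) (fun hQ => ⟨_, hQ⟩)) (fun hQ => ⟨_, hQ⟩)
    obtain ⟨s, h1, h2, h3, h4, -⟩ := hs
    refine (concat_mem_pathsWithLast _ _ _ _).2 ⟨?_, h2, h3, h4, by simp, by simp⟩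
    rw [h1]
    simp only [Step.vec, Prod.ext_iff, Prod.fst_add, Prod.snd_add]
    push_cast
    omega

theorem pathsWithLast_E_succ (h n : ℕ) : pathsWithLast Step.E h (n + 1) =
    (fun P => P ++ [Step.E]) '' (pathsWithLast Step.D (h + 2) n ∪
      pathsWithLast Step.E (h + 2) n) := by
  ext P
  constructor
  · intro hP
    have hne : P ≠ [] := by rintro rfl; exact absurd hP.2.2.2.2 (by decide)
    obtain ⟨Q, rfl⟩ := eq_concat_of_getLast?_getD hne hP.2.2.2.2
    refine ⟨Q, ?_, rfl⟩
    rw [concat_mem_pathsWithLast] at hP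
    obtain ⟨h1, h2, h3, h4, h5, -⟩ := hP
    have he : endpoint Q = ((n : ℤ), ((2 * n + (h + 2) : ℕ) : ℤ)) := by
      simp only [Step.vec, Prod.ext_iff, Prod.fst_add, Prod.snd_add] at h1 ⊢
      push_cast at h1 ⊢
      omega
    cases hs : Q.getLast?.getD Step.N with
    | N =>
      cases hl : Q.getLast? with
      | none =>
        -- The empty path, conventionally ending in `N`, has height 0 and not `h + 2`.
        rw [List.getLast?_eq_none_iff.1 hl] at he
        simp only [endpoint, List.map_nil, List.sum_nil, Prod.ext_iff, Prod.fst_zero,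
          Prod.snd_zero] at he
        push_cast at he
        omega
      | some t => simp [hl] at hs; exact absurd ⟨hs ▸ hl, rfl⟩ h5
    | D => exact Or.inl ⟨he, h2, h3, h4, hs⟩
    | E => exact Or.inr ⟨he, h2, h3, h4, hs⟩
  · rintro ⟨Q, hQ, rfl⟩
    have hs : ∃ s, s ≠ Step.N ∧ Q ∈ pathsWithLast s (h + 2) n :=
      hQ.elim (fun hQ => ⟨_, by decide, hQ⟩) (fun hQ => ⟨_, by decide, hQ⟩)
    obtain ⟨s, hs, h1, h2, h3, h4, h5⟩ := hs
    refine (concat_mem_pathsWithLast _ _ _ _).2 ⟨?_, h2, h3, h4, ?_, by simp⟩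
    · rw [h1]
      simp only [Step.vec, Prod.ext_iff, Prod.fst_add, Prod.snd_add]
      push_cast
      omega
    · rintro ⟨h6, -⟩
      rw [h6] at h5
      exact hs h5.symm

/-! ### Counting by induction on the abscissa -/

theorem ncard_pathsWithLast_N_zero (n : ℕ) :
    ((pathsWithLast Step.N 0 n).ncard : ℚ) = coeff n (lastStepSeries Step.N 0) := by
  rw [lastStepSeries, ternaryPow_zero]
  cases n with
  | zero => simp [pathsWithLast_N_zero_zero]
  | succ n => simp [pathsWithLast_N_zero_succ, coeff_one]

/-- A north step keeps the abscissa, so this case needs an inner induction on `h`, fed by the `D`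
counts at the same `n`. -/
theorem ncard_pathsWithLast_N_of_D {n : ℕ}
    (hD : ∀ h, ((pathsWithLast Step.D h n).ncard : ℚ) = coeff n (lastStepSeries Step.D h))
    (h : ℕ) : ((pathsWithLast Step.N h n).ncard : ℚ) = coeff n (lastStepSeries Step.N h) := by
  induction h with
  | zero => exact ncard_pathsWithLast_N_zero n
  | succ h ih =>
    rw [pathsWithLast_N_succ, Set.ncard_image_of_injective _ (concat_injective _),
      ncard_pathsWithLast_union (by decide), lastStepSeries_N_succ, map_add, ← ih, ← hD]
    push_cast
    rfl

theorem ncard_pathsWithLast (s : Step) (h n : ℕ) :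
    ((pathsWithLast s h n).ncard : ℚ) = coeff n (lastStepSeries s h) := by
  induction n generalizing s h with
  | zero =>
    have hD (h : ℕ) :
        ((pathsWithLast Step.D h 0).ncard : ℚ) = coeff 0 (lastStepSeries Step.D h) := by
      rw [pathsWithLast_D_zero, lastStepSeries_D, coeff_zero_X_mul]
      simp
    cases s with
    | N => exact ncard_pathsWithLast_N_of_D hD h
    | D => exact hD h
    | E =>
      rw [pathsWithLast_E_zero, lastStepSeries_E, coeff_zero_X_mul]
      simp
  | succ n ih =>
    have hD (h : ℕ) : ((pathsWithLast Step.D h (n + 1)).ncard : ℚ) =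
        coeff (n + 1) (lastStepSeries Step.D h) := by
      rw [pathsWithLast_D_succ, Set.ncard_image_of_injective _ (concat_injective _),
        ncard_pathsWithLast_union_three, lastStepSeries_D, coeff_succ_X_mul, map_add, map_add,
        ← ih, ← ih, ← ih]
      push_cast
      rfl
    cases s with
    | N => exact ncard_pathsWithLast_N_of_D hD h
    | D => exact hD h
    | E =>
      rw [pathsWithLast_E_succ, Set.ncard_image_of_injective _ (concat_injective _),
        ncard_pathsWithLast_union (by decide), lastStepSeries_E, coeff_succ_X_mul, map_add,
        ← ih, ← ih]
      push_cast
      rfl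

/-! ### Specialization to height 0 -/

theorem reducedPaths_two (n : ℕ) : reducedPaths 2 n =
    pathsWithLast Step.N 0 n ∪ pathsWithLast Step.D 0 n ∪ pathsWithLast Step.E 0 n := by
  ext P
  simp only [reducedPaths, paths, pathsWithLast, Set.mem_union, Set.mem_ofPred_eq, add_zero]
  cases P.getLast?.getD Step.N <;> simp

theorem reducedPathsD_two (n : ℕ) : reducedPathsD 2 n = pathsWithLast Step.D 0 n := by
  ext P
  simp only [reducedPathsD, reducedPaths, paths, pathsWithLast, Set.mem_ofPred_eq, add_zero,
    and_assoc]
  cases P.getLast? <;> simp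

theorem coeff_F_two (n : ℕ) : coeff n (F 2) = ((reducedPaths 2 n).ncard : ℚ) := by
  simp [F]

theorem coeff_FD_two (n : ℕ) : coeff n (FD 2) = ((reducedPathsD 2 n).ncard : ℚ) := by
  rw [FD, coeff_mk]
  split_ifs with hn
  · rw [hn, reducedPathsD_two, pathsWithLast_D_zero]
    simp
  · rfl

theorem F_two : F 2 = (1 - X) * ternaryPow 2 := by
  ext n
  rw [coeff_F_two, reducedPaths_two, ncard_pathsWithLast_union_three]
  push_cast
  rw [ncard_pathsWithLast, ncard_pathsWithLast, ncard_pathsWithLast, ← map_add, ← map_add]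
  congr 1
  simp only [lastStepSeries]
  ring

theorem FD_two : FD 2 = ternaryPow 1 - ternaryPow 0 := by
  ext n
  rw [coeff_FD_two, reducedPathsD_two, ncard_pathsWithLast]
  rfl

end Delannoy

theorem mainTheorem4 (n : ℕ) :
    (PowerSeries.coeff n (Delannoy.F 2) = ((Delannoy.reducedPaths 2 n).ncard : ℚ) ∧
      PowerSeries.coeff n (Delannoy.F 2) =
        ∑ m ∈ Finset.range (n + 1),
          (-1 : ℚ) ^ (n - m) / ((m : ℚ) + 1) *
            (Nat.choose (3 * m + 1) m : ℚ) * (Nat.choose (m + 1) (n - m) : ℚ)) ∧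
    (PowerSeries.coeff n (Delannoy.FD 2) = ((Delannoy.reducedPathsD 2 n).ncard : ℚ) ∧
      PowerSeries.coeff n (Delannoy.FD 2) =
        ∑ m ∈ Finset.Icc 1 n,
          (-1 : ℚ) ^ (n - m) / (m : ℚ) *
            (Nat.choose (3 * m) (m - 1) : ℚ) * (Nat.choose m (n - m) : ℚ)) := by
  refine ⟨⟨Delannoy.coeff_F_two n, ?_⟩, Delannoy.coeff_FD_two n, ?_⟩
  · rw [Delannoy.F_two, Delannoy.coeff_one_sub_X_mul_ternaryPow]
    refine Finset.sum_congr rfl fun m _ => ?_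
    rw [Delannoy.fussCatalan_two]
    ring
  · rw [Delannoy.FD_two, Delannoy.coeff_ternaryPow_one_sub_one]
    refine Finset.sum_congr rfl fun m hm => ?_
    rw [Delannoy.fussCatalan_one (Finset.mem_Icc.1 hm).1]
    ring
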